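/- Let $N\ge 1$. A Dellac configuration of length $N$ is a tableau with $N$ columns (numbered from left to right) and $2N$ rows (numbered from bottom to top) containing $2N$ points placed in distinct boxes, exactly one in each row and exactly two in each column, such that whenever the box in column $j$ and row $i$ contains a point, $j\le i\le N+j$. Let $SDC_N$ be the set of Dellac configurations of length $N$ that are invariant under the rotation by $\pi$ about the center of the tableau, i.e. under $(j,i)\mapsto(N+1-j,\,2N+1-i)$. Define polynomials by $$D_0(x)=1,\qquad D_{n+1}(x)=(x+1)(x+2)D_n(x+2)-x(x+1)D_n(x)\quad(n\ge 0),$$ $$P_1(x)=1,\qquad P_{n+1}(x)=\frac{(x+2)(x+1)}{2}P_n(x+2)-\frac{x(x-1)}{2}P_n(x)\quad(n\ge 1),$$ and let $l_n=D_n(0)/2^n$ for $n\ge 0$. Then for every $n\ge 1$, $$|SDC_{2n-1}| = l_n = P_n(1).$$ Moreover, $l_0,l_1,l_2,l_3,l_4 = 1,1,3,21,267$. -/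

import Mathlib

open Polynomial

/-- A tableau with `N` columns and `2N` rows, given by the finite set of its boxes that
contain a point. The box in column `j` (from the left) and row `i` (from the bottom) is
`(j, i)`; both coordinates are numbered from `0`. -/
abbrev DellacTableau (N : ℕ) : Type := Finset (Fin N × Fin (2 * N))

/-- `T` is a Dellac configuration: one point per row, two points per column, and every point
lies in a box `(j, i)` with `j ≤ i ≤ N + j` (between the lines `y = x` and `y = N + x`; this
condition is the same for coordinates numbered from `0` and from `1`). -/
def IsDellac {N : ℕ} (T : DellacTableau N) : Prop :=
  (∀ i : Fin (2 * N), (T.filter fun p => p.2 = i).card = 1) ∧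
  (∀ j : Fin N, (T.filter fun p => p.1 = j).card = 2) ∧
  (∀ p ∈ T, (p.1 : ℕ) ≤ (p.2 : ℕ) ∧ (p.2 : ℕ) ≤ N + (p.1 : ℕ))

instance instDecidableIsDellac {N : ℕ} (T : DellacTableau N) : Decidable (IsDellac T) := by
  unfold IsDellac; infer_instance

/-- The rotation by `π` about the center `(N/2, N)` of the tableau: it sends column `j` to
column `N - 1 - j` and row `i` to row `2N - 1 - i`. -/
def dellacRotation {N : ℕ} (T : DellacTableau N) : DellacTableau N :=
  T.image fun p => (Fin.rev p.1, Fin.rev p.2)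

/-- The finite set `SDC_N` of symmetric Dellac configurations. -/
def symmetricDellac (N : ℕ) : Finset (DellacTableau N) :=
  Finset.univ.filter fun T => IsDellac T ∧ dellacRotation T = T

/-- The polynomials `D_n(x)`: `D_0 = 1` and
`D_{n+1}(x) = (x+1)(x+2) D_n(x+2) - x(x+1) D_n(x)`. -/
noncomputable def eulerD : ℕ → ℤ[X]
  | 0 => 1
  | n + 1 => (X + 1) * (X + 2) * (eulerD n).comp (X + 2) - X * (X + 1) * eulerD n

/-- The polynomials `P_n(x)`, `n ≥ 1`: `P_1 = 1` and
`P_{n+1}(x) = ((x+2)(x+1)/2) P_n(x+2) - (x(x-1)/2) P_n(x)`.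
The value at `n = 0` is a placeholder. -/
noncomputable def eulerP : ℕ → ℚ[X]
  | 0 => 0
  | 1 => 1
  | n + 2 => C (1 / 2) * ((X + 2) * (X + 1)) * (eulerP (n + 1)).comp (X + 2)
      - C (1 / 2) * (X * (X - 1)) * eulerP (n + 1)

/-- The sequence `l_n = D_n(0) / 2^n`, `n ≥ 0`. -/
noncomputable def seqL (n : ℕ) : ℚ := (((eulerD n).eval 0 : ℤ) : ℚ) / 2 ^ n

/-!
A centrally symmetric Dellac configuration of length `2m + 1` is determined by its lower half, that
is, by a function `g` on the rows `0, …, 2m` with `g i ≤ i` such that the columns `j` and `2m - j`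
together are hit twice (`isDellac_symmetricTableau_iff`). These functions are counted by peeling off
the outermost pair of columns. If `a` rows are available to the top column and it takes `e` of them,
then the next column sees `a + 1 - e` rows, and the same number `a + 1 - e` of rows is left for the
bottom column after the inner columns are filled. Hence (`card_fillings`) the counts `h_m(a)` satisfy
`h_0(a) = a` and

  `h_{m+1}(a) = (a+1 choose 2) h_m(a+1) + a² h_m(a) + (a choose 2) h_m(a-1)`,

and the number of symmetric configurations is `h_m(1)`.

On the other side, `F_m(k) = P_{m+1}(2k+1)` satisfies `F_0 = 1` and
`F_{m+1}(k) = (k+1)(2k+3) F_m(k+1) - k(2k+1) F_m(k)`, and `D_{m+1}(2k) = 2^{m+1} (2k+1) F_m(k)` by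
comparing recurrences (`eulerD_eval_two_mul`), so that `l_{m+1} = F_m(0) = P_{m+1}(1)`.

The two families are related by

  `h_m(a) = ∑_{k < a} (-1)^{a-1-k} (a-1 choose k) (a+k choose k) F_m(k)`

(`layerCount_eq_altTransform`): the coefficients intertwine the two recurrences
(`centralProd_recurrence`), and for `m = 0` the sum is a finite difference of a binomial coefficient
with value `a`. At `a = 1` only the term `F_m(0)` is left.
-/

/-! ### Evaluations of the polynomials -/

/-- The values of `P_{m+1}` at the odd integers `2k + 1`. -/
noncomputable def oddValue (m k : ℕ) : ℚ := (eulerP (m + 1)).eval (2 * (k : ℚ) + 1)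

lemma oddValue_zero (k : ℕ) : oddValue 0 k = 1 := by simp [oddValue, eulerP]

lemma oddValue_succ (m k : ℕ) :
    oddValue (m + 1) k = ((k : ℚ) + 1) * (2 * k + 3) * oddValue m (k + 1)
      - (k : ℚ) * (2 * k + 1) * oddValue m k := by
  have h : (2 * (k : ℚ) + 1 + 2) = 2 * ((k + 1 : ℕ) : ℚ) + 1 := by push_cast; ring
  simp only [oddValue, eulerP, eval_sub, eval_mul, eval_comp, eval_add, eval_X, eval_C,
    eval_ofNat, eval_one, h]
  push_cast
  ring

/-- `D_{m+1}(2k) = 2^{m+1} (2k+1) P_{m+1}(2k+1)`: dividing the values of `D` at even integers by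
`2^{m+1} (2k+1)` turns their recurrence into that of `oddValue`. -/
lemma eulerD_eval_two_mul (m k : ℕ) :
    (((eulerD (m + 1)).eval (2 * (k : ℤ)) : ℤ) : ℚ)
      = 2 ^ (m + 1) * (2 * k + 1) * oddValue m k := by
  induction m generalizing k with
  | zero => simp [eulerD, oddValue_zero]; ring
  | succ m ih =>
    have h : (2 * (k : ℤ) + 2) = 2 * ((k + 1 : ℕ) : ℤ) := by push_cast; ring
    have ih1 := ih (k + 1)
    rw [eulerD]
    simp only [eval_sub, eval_mul, eval_comp, eval_add, eval_X, eval_ofNat, eval_one, h]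
    push_cast at ih1 ⊢
    rw [ih1, ih k, oddValue_succ]
    ring

lemma seqL_succ (m : ℕ) : seqL (m + 1) = oddValue m 0 := by
  have h := eulerD_eval_two_mul m 0
  simp only [Nat.cast_zero, mul_zero] at h
  rw [seqL, h]
  field_simp
  ring

/-! ### A transform between the two recurrences -/

/-- `centralProd k a = ∏_{j=1}^{k} (a² - j²) / j²`; for integers `a > k` this is
`(a-1 choose k) (a+k choose k)`. The product form is a polynomial in `a`, even in `a`. -/
def centralProd : ℕ → ℚ → ℚ
  | 0, _ => 1
  | k + 1, a => centralProd k a * ((a ^ 2 - ((k : ℚ) + 1) ^ 2) / ((k : ℚ) + 1) ^ 2)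

lemma centralProd_neg (k : ℕ) (a : ℚ) : centralProd k (-a) = centralProd k a := by
  induction k with
  | zero => rfl
  | succ k ih => simp [centralProd, ih]

lemma centralProd_eq_zero {k a : ℕ} (ha : 1 ≤ a) (hk : a ≤ k) : centralProd k a = 0 := by
  induction k, hk using Nat.le_induction with
  | base =>
    obtain ⟨b, rfl⟩ := Nat.exists_eq_add_of_le' ha
    simp [centralProd]
  | succ k _ ih => simp [centralProd, ih]

lemma centralProd_eq_choose (k n : ℕ) :
    centralProd k ((n : ℚ) + 1) = n.choose k * (n + 1 + k).choose (n + 1) := by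
  induction k with
  | zero => simp [centralProd]
  | succ k ih =>
    rw [centralProd, ih]
    have h1 : ((n.choose (k + 1) : ℕ) : ℚ) * (k + 1) = n.choose k * ((n : ℚ) - k) := by
      rcases le_or_gt k n with h | h
      · have := Nat.choose_succ_right_eq n k
        rw [← Nat.cast_sub h]
        exact_mod_cast this
      · simp [Nat.choose_eq_zero_of_lt h, Nat.choose_eq_zero_of_lt (Nat.lt_succ_of_lt h)]
    have h2 : (((n + 1 + (k + 1)).choose (n + 1) : ℕ) : ℚ) * (k + 1)
        = (n + 1 + k).choose (n + 1) * ((n : ℚ) + k + 2) := by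
      have := Nat.choose_mul_succ_eq (n + 1 + k) (n + 1)
      have e : n + 1 + k + 1 - (n + 1) = k + 1 := by omega
      rw [e] at this
      have := congrArg (Nat.cast : ℕ → ℚ) this
      push_cast at this
      rw [show n + 1 + (k + 1) = n + 1 + k + 1 by ring]
      linear_combination -this
    have hk : ((k : ℚ) + 1) ≠ 0 := by positivity
    field_simp
    linear_combination -(((n + 1 + (k + 1)).choose (n + 1) : ℕ) : ℚ) * (k + 1) * h1
      - n.choose k * ((n : ℚ) - k) * h2

lemma centralProd_add_one (k : ℕ) (a : ℚ) :
    (a + 1) * ((k : ℚ) + 1) ^ 2 * centralProd (k + 1) (a + 1)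
      = a * (a + k + 2) * (a + k + 1) * centralProd k a := by
  induction k generalizing a with
  | zero => simp [centralProd]; ring
  | succ k ih =>
    have hk : ((k : ℚ) + 1) ≠ 0 := by positivity
    have hk' : ((k : ℚ) + 1 + 1) ≠ 0 := by positivity
    have h := ih a
    have e1 : centralProd (k + 1 + 1) (a + 1) = centralProd (k + 1) (a + 1)
        * (((a + 1) ^ 2 - ((k + 1 : ℕ) + 1 : ℚ) ^ 2) / ((k + 1 : ℕ) + 1 : ℚ) ^ 2) := rfl
    have e2 : centralProd (k + 1) a
        = centralProd k a * ((a ^ 2 - ((k : ℚ) + 1) ^ 2) / ((k : ℚ) + 1) ^ 2) := rfl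
    rw [e1, e2]
    push_cast
    field_simp
    linear_combination ((a + 1) ^ 2 - (k + 1 + 1) ^ 2) * h

lemma centralProd_sub_one (k : ℕ) (a : ℚ) :
    (a - 1) * ((k : ℚ) + 1) ^ 2 * centralProd (k + 1) (a - 1)
      = a * (a - k - 2) * (a - k - 1) * centralProd k a := by
  have h := centralProd_add_one k (-a)
  rw [show -a + 1 = -(a - 1) by ring, centralProd_neg, centralProd_neg] at h
  linear_combination -h

/-- On the coefficients of the transform, the three-term operator in `a` of `layerCount` acts as the
transpose of the two-term operator in `k` of `oddValue`. -/
lemma centralProd_recurrence (k : ℕ) (a : ℚ) :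
    (a + 1) * a / 2 * centralProd (k + 1) (a + 1) - a ^ 2 * centralProd (k + 1) a
      + a * (a - 1) / 2 * centralProd (k + 1) (a - 1)
      = ((k : ℚ) + 1) * (2 * k + 3) * (centralProd k a + centralProd (k + 1) a) := by
  have h1 := centralProd_add_one k a
  have h2 := centralProd_sub_one k a
  have hk : ((k : ℚ) + 1) ≠ 0 := by positivity
  have h3 : ((k : ℚ) + 1) ^ 2 * centralProd (k + 1) a
      = (a ^ 2 - (k + 1) ^ 2) * centralProd k a := by
    rw [centralProd]; field_simp
  apply mul_left_cancel₀ (pow_ne_zero 2 hk)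
  linear_combination a / 2 * h1 + a / 2 * h2 - (a ^ 2 + ((k : ℚ) + 1) * (2 * k + 3)) * h3

/-- The alternating sum `∑_k (-1)^(a-1-k) centralProd k a · F k`, cut off at `K`. -/
def altTransform (F : ℕ → ℚ) (K a : ℕ) : ℚ :=
  ∑ k ∈ Finset.range K, (-1) ^ (a + 1 + k) * centralProd k a * F k

lemma altTransform_succ (F : ℕ → ℚ) (K a : ℕ) : altTransform F (K + 1) a
    = altTransform F K a + (-1) ^ (a + 1 + K) * centralProd K a * F K :=
  Finset.sum_range_succ _ K

lemma altTransform_eq {F : ℕ → ℚ} {K a : ℕ} (ha : 1 ≤ a) (hK : a ≤ K) :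
    altTransform F K a = altTransform F a a := by
  induction K, hK using Nat.le_induction with
  | base => rfl
  | succ K hK ih =>
    rw [altTransform_succ, centralProd_eq_zero ha hK, ← ih]
    simp

/-- The sum is an `n`-th finite difference, for `n = a - 1`, of the function
`x ↦ x.choose (n + 1)`. -/
lemma altTransform_one {a : ℕ} (ha : 1 ≤ a) : altTransform (fun _ => 1) a a = a := by
  obtain ⟨n, rfl⟩ := Nat.exists_eq_add_of_le' ha
  have h := fwdDiff_iter_eq_sum_shift 1 (fun x ↦ x.choose (n + 1) : ℕ → ℤ) n (n + 1)
  rw [fwdDiff_iter_choose 1 n] at h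
  have h' := congrArg (Int.cast : ℤ → ℚ) h
  simp only [Nat.choose_one_right, Int.cast_natCast, smul_eq_mul, Int.cast_sum, mul_one] at h'
  rw [h', altTransform]
  refine Finset.sum_congr rfl fun k hk => ?_
  have hkn : k ≤ n := Nat.lt_succ_iff.mp (Finset.mem_range.mp hk)
  push_cast
  rw [centralProd_eq_choose]
  obtain ⟨d, rfl⟩ := Nat.exists_eq_add_of_le hkn
  rw [show k + d + 1 + 1 + k = 2 * (k + 1) + d by ring, Nat.add_sub_cancel_left, pow_add, pow_mul]
  norm_num
  ring

/-- The transform turns the three-term operator in `a` into the two-term operator in `k`, up to a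
boundary term at the cut-off, which vanishes once `K ≥ a`. -/
lemma altTransform_step (F : ℕ → ℚ) {a : ℕ} (ha : 1 ≤ a) (K : ℕ) :
    ((a : ℚ) + 1) * a / 2 * altTransform F (K + 1) (a + 1) + (a : ℚ) ^ 2 * altTransform F (K + 1) a
      + (a : ℚ) * (a - 1) / 2 * altTransform F (K + 1) (a - 1)
    = altTransform (fun k => ((k : ℚ) + 1) * (2 * k + 3) * F (k + 1)
        - (k : ℚ) * (2 * k + 1) * F k) K a
      - (K : ℚ) * (2 * K + 1) * ((-1) ^ (a + 1 + K) * centralProd K a * F K) := by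
  obtain ⟨n, rfl⟩ := Nat.exists_eq_add_of_le' ha
  rw [Nat.add_sub_cancel]
  induction K with
  | zero =>
    simp [altTransform, centralProd]
    ring
  | succ K ih =>
    have h := centralProd_recurrence K ((n : ℚ) + 1)
    rw [altTransform_succ F (K + 1) (n + 1 + 1), altTransform_succ F (K + 1) (n + 1),
      altTransform_succ F (K + 1) n, altTransform_succ (fun k => ((k : ℚ) + 1) * (2 * k + 3)
        * F (k + 1) - (k : ℚ) * (2 * k + 1) * F k) K (n + 1)]
    push_cast at ih ⊢
    rw [add_sub_cancel_right] at h
    linear_combination ih + (-1) ^ (n + K) * F (K + 1) * h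

/-- The number of fillings of `2m + 1` columns when `a` rows are available to the top column. The
three terms are for `0`, `1` or `2` rows in the top column, hence `2`, `1` or `0` in the bottom one.
In the last term `a - 1` is truncated at `a = 0`, where its coefficient vanishes. -/
def layerCount : ℕ → ℕ → ℕ
  | 0, a => a
  | m + 1, a => (a + 1).choose 2 * layerCount m (a + 1) + a * a * layerCount m a
      + a.choose 2 * layerCount m (a - 1)

lemma layerCount_eq_altTransform (m : ℕ) {a : ℕ} (ha : 1 ≤ a) :
    (layerCount m a : ℚ) = altTransform (oddValue m) a a := by
  induction m generalizing a with
  | zero =>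
    rw [show oddValue 0 = fun _ => 1 from funext oddValue_zero, altTransform_one ha]
    rfl
  | succ m ih =>
    rw [show oddValue (m + 1) = _ from funext (oddValue_succ m)]
    have h := altTransform_step (oddValue m) ha a
    rw [centralProd_eq_zero ha le_rfl, altTransform_eq ha (Nat.le_succ a),
      ← ih (Nat.le_add_left 1 a), ← ih ha] at h
    -- the coefficient vanishes at `a = 1`, where the induction hypothesis does not apply to `a - 1`
    have h3 : (a : ℚ) * (a - 1) / 2 * altTransform (oddValue m) (a + 1) (a - 1)
        = (a : ℚ) * (a - 1) / 2 * layerCount m (a - 1) := by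
      rcases Nat.eq_or_lt_of_le ha with rfl | h2
      · simp
      · rw [altTransform_eq (by omega) (by omega), ih (by omega)]
    rw [h3] at h
    simp only [layerCount, Nat.cast_add, Nat.cast_mul, Nat.cast_choose_two]
    push_cast
    linear_combination h

lemma layerCount_one (m : ℕ) : (layerCount m 1 : ℚ) = oddValue m 0 := by
  rw [layerCount_eq_altTransform m le_rfl]
  simp [altTransform, centralProd]

/-! ### Counting fillings layer by layer -/

section Fillings

variable {ι : Type*} [Fintype ι] [DecidableEq ι]

open Classical in
/-- Assignments of the rows `i : ι` to the columns `1, …, 2m + 1`, where row `i` may use only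
columns `≤ ρ i` and the value `0` means that the row stays unused, such that the columns `k` and
`2m + 2 - k` contain two rows together. -/
noncomputable def fillings (ρ : ι → ℕ) (m : ℕ) : Finset (ι → ℕ) :=
  (Fintype.piFinset fun i => Finset.range (min (ρ i) (2 * m + 1) + 1)).filter fun f : ι → ℕ =>
    ∀ k ∈ Finset.Icc 1 (2 * m + 1),
      (Finset.univ.filter fun i => f i = k).card
        + (Finset.univ.filter fun i => f i = 2 * m + 2 - k).card = 2

lemma mem_fillings {ρ : ι → ℕ} {m : ℕ} {f : ι → ℕ} : f ∈ fillings ρ m ↔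
    (∀ i, f i ≤ ρ i ∧ f i ≤ 2 * m + 1) ∧ ∀ k, 1 ≤ k → k ≤ 2 * m + 1 →
      (Finset.univ.filter fun i => f i = k).card
        + (Finset.univ.filter fun i => f i = 2 * m + 2 - k).card = 2 := by
  simp [fillings]

/-- Summing the condition on the columns `k` and `2m + 2 - k` over all `k` counts every used row
twice. -/
lemma card_ne_zero_of_mem_fillings {ρ : ι → ℕ} {m : ℕ} {f : ι → ℕ} (hf : f ∈ fillings ρ m) :
    (Finset.univ.filter fun i => f i ≠ 0).card = 2 * m + 1 := by
  rw [mem_fillings] at hf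
  have h1 : (Finset.univ.filter fun i => f i ≠ 0).card
      = ∑ k ∈ Finset.Icc 1 (2 * m + 1), (Finset.univ.filter fun i => f i = k).card := by
    rw [Finset.card_eq_sum_card_fiberwise (f := f) (t := Finset.Icc 1 (2 * m + 1))]
    · refine Finset.sum_congr rfl fun k hk => ?_
      congr 1
      ext i
      simp only [Finset.mem_Icc, Finset.mem_filter, Finset.mem_univ, true_and] at hk ⊢
      omega
    · intro i hi
      have := hf.1 i
      simp only [Finset.coe_filter, Finset.mem_univ, true_and, Set.mem_ofPred_eq,
        Finset.coe_Icc, Set.mem_Icc] at hi ⊢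
      omega
  have h2 : ∑ k ∈ Finset.Icc 1 (2 * m + 1), (Finset.univ.filter fun i => f i = k).card
      = ∑ k ∈ Finset.Icc 1 (2 * m + 1),
        (Finset.univ.filter fun i => f i = 2 * m + 2 - k).card := by
    refine Finset.sum_nbij' (fun k => 2 * m + 2 - k) (fun k => 2 * m + 2 - k) ?_ ?_ ?_ ?_ ?_
    · intro k hk; simp only [Finset.mem_Icc] at hk ⊢; omega
    · intro k hk; simp only [Finset.mem_Icc] at hk ⊢; omega
    · intro k hk; simp only [Finset.mem_Icc] at hk; omega
    · intro k hk; simp only [Finset.mem_Icc] at hk; omega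
    · intro k hk
      simp only [Finset.mem_Icc] at hk
      rw [show 2 * m + 2 - (2 * m + 2 - k) = k by omega]
  have h3 : ∑ k ∈ Finset.Icc 1 (2 * m + 1), ((Finset.univ.filter fun i => f i = k).card
      + (Finset.univ.filter fun i => f i = 2 * m + 2 - k).card) = 2 * (2 * m + 1) := by
    rw [Finset.sum_congr rfl fun k hk => hf.2 k (Finset.mem_Icc.mp hk).1 (Finset.mem_Icc.mp hk).2]
    simp [mul_comm]
  rw [Finset.sum_add_distrib] at h3
  omega

/-- The rows left over by the inner filling once the top column has taken the rows in `A`: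
the bound of every row drops by one, and the rows in `A` become unusable. -/
def peelBound (ρ : ι → ℕ) (A : Finset ι) (i : ι) : ℕ := if i ∈ A then 0 else ρ i - 1

/-- The inner filling: forget the top column and merge the bottom column with the unused rows. -/
def peel (m : ℕ) (f : ι → ℕ) (i : ι) : ℕ := if f i = 2 * m + 3 then 0 else f i - 1

/-- Put the outer columns back: the rows in `A` go to the top column, those in `B` to the bottom
one. -/
def unpeel (m : ℕ) (A : Finset ι) (g : ι → ℕ) (B : Finset ι) (i : ι) : ℕ :=
  if i ∈ A then 2 * m + 3 else if i ∈ B then 1 else if g i = 0 then 0 else g i + 1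

/-- The rows available for the bottom column. -/
def bottomRows (ρ : ι → ℕ) (A : Finset ι) (g : ι → ℕ) : Finset ι :=
  Finset.univ.filter fun i => i ∉ A ∧ 1 ≤ ρ i ∧ g i = 0

lemma peel_mem_fillings {ρ : ι → ℕ} {m : ℕ} {f : ι → ℕ} (hf : f ∈ fillings ρ (m + 1)) :
    peel m f ∈ fillings (peelBound ρ (Finset.univ.filter fun i => f i = 2 * m + 3)) m := by
  rw [mem_fillings] at hf ⊢
  have key : ∀ k, 1 ≤ k → k ≤ 2 * m + 1 → ∀ i, peel m f i = k ↔ f i = k + 1 := by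
    intro k hk hk' i
    rw [peel]
    split_ifs <;> omega
  constructor
  · intro i
    have := hf.1 i
    simp only [peel, peelBound, Finset.mem_filter, Finset.mem_univ, true_and]
    split_ifs <;> omega
  · intro k hk hk'
    have h := hf.2 (k + 1) (by omega) (by omega)
    rw [show 2 * (m + 1) + 2 - (k + 1) = 2 * m + 2 - k + 1 by omega] at h
    simpa only [key k hk hk', key (2 * m + 2 - k) (by omega) (by omega)] using h

lemma filter_unpeel_eq_top {m : ℕ} {A : Finset ι} {g : ι → ℕ} (B : Finset ι)
    (hg : ∀ i, g i ≤ 2 * m + 1) :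
    (Finset.univ.filter fun i => unpeel m A g B i = 2 * m + 3) = A := by
  ext i
  have := hg i
  simp only [Finset.mem_filter, Finset.mem_univ, true_and]
  rw [unpeel]
  split_ifs with c1 c2 c3 <;> simp only [c1, iff_false] <;> omega

lemma filter_unpeel_eq_bot {m : ℕ} {A B : Finset ι} {g : ι → ℕ} (hB : ∀ i ∈ B, i ∉ A) :
    (Finset.univ.filter fun i => unpeel m A g B i = 1) = B := by
  ext i
  have h2 := hB i
  simp only [Finset.mem_filter, Finset.mem_univ, true_and]
  rw [unpeel]
  split_ifs with c1 c2 c3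
  · have : i ∉ B := fun h => h2 h c1
    simp only [this, iff_false]; omega
  · simp [c2]
  · simp [c2]
  · simp only [c2, iff_false]; omega

lemma unpeel_mem_fillings {ρ : ι → ℕ} {m : ℕ} {A B : Finset ι} {g : ι → ℕ}
    (hA : ∀ i ∈ A, 2 * m + 3 ≤ ρ i) (hg : g ∈ fillings (peelBound ρ A) m)
    (hB : B ⊆ bottomRows ρ A g) (hAB : A.card + B.card = 2) :
    unpeel m A g B ∈ fillings ρ (m + 1) := by
  rw [mem_fillings] at hg ⊢
  have hB' : ∀ i ∈ B, i ∉ A ∧ 1 ≤ ρ i ∧ g i = 0 := fun i hi => by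
    simpa [bottomRows] using hB hi
  have hgA : ∀ i ∈ A, g i = 0 := fun i hi => by
    have := (hg.1 i).1
    simpa [peelBound, hi] using this
  have key : ∀ k, 1 ≤ k → k ≤ 2 * m + 1 → ∀ i, unpeel m A g B i = k + 1 ↔ g i = k := by
    intro k hk hk' i
    have h1 := hgA i
    have h2 := hB' i
    rw [unpeel]
    split_ifs with c1 c2 c3
    · have := h1 c1; omega
    · have := (h2 c2).2.2; omega
    · simp only [false_iff]; omega
    · omega
  have top := filter_unpeel_eq_top (A := A) B fun i => (hg.1 i).2
  have bot := filter_unpeel_eq_bot (m := m) (g := g) fun i hi => (hB' i hi).1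
  constructor
  · intro i
    have h1 := hA i
    have h2 := hB' i
    have h3 := hg.1 i
    simp only [peelBound] at h3
    rw [unpeel]
    split_ifs at h3 ⊢ with c1 c2 c3
    · have := h1 c1; omega
    · have := h2 c2; omega
    · omega
    · omega
  · intro k hk hk'
    rcases Nat.eq_or_lt_of_le hk with rfl | hk1
    · rw [show 2 * (m + 1) + 2 - 1 = 2 * m + 3 by omega, top, bot,
        add_comm, hAB]
    rcases Nat.eq_or_lt_of_le hk' with rfl | hk2
    · rw [show 2 * (m + 1) + 2 - (2 * (m + 1) + 1) = 1 by omega,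
        show 2 * (m + 1) + 1 = 2 * m + 3 by omega, top, bot, hAB]
    obtain ⟨l, rfl⟩ := Nat.exists_eq_add_of_le' hk
    rw [show 2 * (m + 1) + 2 - (l + 1) = 2 * m + 2 - l + 1 by omega]
    simpa only [key l (by omega) (by omega), key (2 * m + 2 - l) (by omega) (by omega)]
      using hg.2 l (by omega) (by omega)

/-- Peeling off the two outermost columns is a bijection onto triples (rows of the top column,
inner filling, rows of the bottom column). -/
lemma card_fillings_succ_eq_sum (ρ : ι → ℕ) (m : ℕ) :
    (fillings ρ (m + 1)).card
      = ∑ A ∈ (Finset.univ.filter fun i => 2 * m + 3 ≤ ρ i).powerset with A.card ≤ 2,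
        ∑ g ∈ fillings (peelBound ρ A) m, ((bottomRows ρ A g).powersetCard (2 - A.card)).card := by
  simp_rw [← Finset.card_sigma]
  refine Finset.card_nbij'
    (fun f => ⟨Finset.univ.filter fun i => f i = 2 * m + 3, peel m f,
      Finset.univ.filter fun i => f i = 1⟩)
    (fun t => unpeel m t.1 t.2.1 t.2.2) ?_ ?_ ?_ ?_
  · intro f hf
    have hf' := mem_fillings.mp hf
    have h2 := hf'.2 1 (by omega) (by omega)
    rw [show 2 * (m + 1) + 2 - 1 = 2 * m + 3 by omega] at h2
    simp only [Finset.coe_sigma, Set.mem_sigma_iff, Finset.mem_coe, Finset.mem_filter,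
      Finset.mem_powerset, Finset.mem_powersetCard]
    refine ⟨⟨?_, by omega⟩, peel_mem_fillings hf, ?_, by omega⟩
    · intro i hi
      have := hf'.1 i
      simp only [Finset.mem_filter, Finset.mem_univ, true_and] at hi ⊢
      omega
    · intro i hi
      have := hf'.1 i
      simp only [Finset.mem_filter, Finset.mem_univ, true_and, bottomRows, peel] at hi ⊢
      refine ⟨by omega, by omega, ?_⟩
      split_ifs <;> omega
  · rintro ⟨A, g, B⟩ h
    simp only [Finset.coe_sigma, Set.mem_sigma_iff, Finset.mem_coe, Finset.mem_filter,
      Finset.mem_powerset, Finset.mem_powersetCard] at h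
    obtain ⟨⟨hA, hA2⟩, hg, hB, hBc⟩ := h
    refine unpeel_mem_fillings (fun i hi => by simpa using hA hi) hg hB ?_
    dsimp only
    omega
  · intro f hf
    funext i
    simp only [unpeel, peel, Finset.mem_filter, Finset.mem_univ, true_and]
    split_ifs <;> omega
  · rintro ⟨A, g, B⟩ h
    simp only [Finset.coe_sigma, Set.mem_sigma_iff, Finset.mem_coe, Finset.mem_filter,
      Finset.mem_powerset, Finset.mem_powersetCard] at h
    obtain ⟨⟨hA, hA2⟩, hg, hB, hBc⟩ := h
    have hg' := (mem_fillings.mp hg).1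
    have hB' : ∀ i ∈ B, i ∉ A ∧ 1 ≤ ρ i ∧ g i = 0 := fun i hi => by
      simpa [bottomRows] using hB hi
    have e1 := filter_unpeel_eq_top (A := A) B fun i => (hg' i).2
    have e2 : peel m (unpeel m A g B) = g := by
      funext i
      have h1 := hg' i
      have h2 := hB' i
      simp only [peelBound] at h1
      simp only [peel, unpeel]
      split_ifs at h1 ⊢ with c1 c2 c3 c4 c5 c6 <;> first | omega | (have := h2 ‹_›; omega)
    have e3 := filter_unpeel_eq_bot (m := m) (g := g) fun i hi => (hB' i hi).1
    simp only [e1, e2, e3]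

lemma card_bottomRows {ρ : ι → ℕ} {m a : ℕ} {A : Finset ι} {g : ι → ℕ}
    (hρ : (Finset.univ.filter fun i => 1 ≤ ρ i).card = a + 2 * m + 2)
    (hA : ∀ i ∈ A, 2 * m + 3 ≤ ρ i) (hg : g ∈ fillings (peelBound ρ A) m) :
    (bottomRows ρ A g).card = a + 1 - A.card := by
  have hg' := (mem_fillings.mp hg).1
  have hne := card_ne_zero_of_mem_fillings hg
  have hle : ∀ i, g i ≠ 0 → i ∉ A ∧ 1 ≤ ρ i := by
    intro i hi
    have := (hg' i).1
    simp only [peelBound] at this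
    split_ifs at this with h
    · omega
    · exact ⟨h, by omega⟩
  have hdec : (Finset.univ.filter fun i => 1 ≤ ρ i)
      = bottomRows ρ A g ∪ (A ∪ Finset.univ.filter fun i => g i ≠ 0) := by
    ext i
    have h1 := hA i
    have h2 := hle i
    simp only [bottomRows, Finset.mem_filter, Finset.mem_univ, true_and, Finset.mem_union]
    by_cases hi : i ∈ A
    · have := h1 hi
      simp only [hi, true_or, or_true, iff_true]; omega
    by_cases h0 : g i = 0
    · simp [hi, h0]
    · simpa [hi, h0] using (h2 h0).2
  have d1 : Disjoint A (Finset.univ.filter fun i => g i ≠ 0) := by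
    rw [Finset.disjoint_left]
    intro i hi h
    exact (hle i (by simpa using h)).1 hi
  have d2 : Disjoint (bottomRows ρ A g) (A ∪ Finset.univ.filter fun i => g i ≠ 0) := by
    rw [Finset.disjoint_left]
    intro i hi h
    simp only [bottomRows, Finset.mem_filter, Finset.mem_univ, true_and, Finset.mem_union] at hi h
    tauto
  rw [hdec, Finset.card_union_of_disjoint d2, Finset.card_union_of_disjoint d1, hne] at hρ
  omega

lemma card_le_peelBound {ρ : ι → ℕ} {m k : ℕ} {A : Finset ι} (hA : ∀ i ∈ A, 2 * m + 3 ≤ ρ i)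
    (hk : 1 ≤ k) (hk' : k ≤ 2 * m + 1) :
    (Finset.univ.filter fun i => k ≤ peelBound ρ A i).card + A.card
      = (Finset.univ.filter fun i => k + 1 ≤ ρ i).card := by
  rw [← Finset.card_union_of_disjoint]
  · congr 1
    ext i
    have h1 := hA i
    simp only [Finset.mem_filter, Finset.mem_univ, true_and, Finset.mem_union]
    rw [peelBound]
    split_ifs with h
    · have := h1 h
      simp only [h, or_true, true_iff]; omega
    · simp only [h, or_false]; omega
  · rw [Finset.disjoint_left]
    intro i hi h
    simp only [Finset.mem_filter, Finset.mem_univ, true_and] at hi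
    rw [peelBound, if_pos h] at hi
    omega

/-- If `a` rows are available to the top column and each lower column sees exactly one further
row, the number of fillings depends only on `a`. Given the set `A` taken by the top column, the
inner filling leaves `a + 1 - |A|` rows to the bottom column whatever it is, so the sum over triples
factors. -/
lemma card_fillings (m : ℕ) : ∀ (ρ : ι → ℕ) (a : ℕ),
    (∀ k, 1 ≤ k → k ≤ 2 * m + 1 →
      (Finset.univ.filter fun i => k ≤ ρ i).card + k = a + 2 * m + 1) →
    (fillings ρ m).card = layerCount m a := by
  induction m with
  | zero =>
    intro ρ a h
    have h1 := h 1 le_rfl le_rfl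
    have h2 : (Finset.univ.filter fun i => 1 ≤ ρ i).card = a := by omega
    rw [layerCount, ← h2]
    symm
    refine Finset.card_bij (fun i _ j => if j = i then 1 else 0) ?_ ?_ ?_
    · intro i hi
      rw [mem_fillings]
      simp only [Finset.mem_filter, Finset.mem_univ, true_and] at hi
      refine ⟨fun j => ?_, fun k hk hk' => ?_⟩
      · split_ifs with h
        · subst h; omega
        · omega
      · obtain rfl : k = 1 := by omega
        simp [Finset.filter_eq']
    · intro i _ j _ h
      have := congrFun h i
      by_contra hij
      simp [hij] at this
    · intro f hf
      rw [mem_fillings] at hf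
      have h3 := hf.2 1 le_rfl le_rfl
      have h4 : (Finset.univ.filter fun i => f i = 1).card = 1 := by
        simp only [mul_zero, zero_add, Nat.reduceSub] at h3; omega
      obtain ⟨i, hi⟩ := Finset.card_eq_one.mp h4
      have hi' : ∀ j, f j = 1 ↔ j = i := fun j => by
        have : j ∈ (Finset.univ.filter fun i => f i = 1) ↔ j ∈ ({i} : Finset ι) := by rw [hi]
        simpa using this
      refine ⟨i, ?_, ?_⟩
      · have := hf.1 i
        have := (hi' i).mpr rfl
        simp only [Finset.mem_filter, Finset.mem_univ, true_and]
        omega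
      · funext j
        have h5 := hf.1 j
        split_ifs with c
        · exact ((hi' j).mpr c).symm
        · have := mt (hi' j).mp c
          omega
  | succ m ih =>
    intro ρ a h
    have htop : (Finset.univ.filter fun i => 2 * m + 3 ≤ ρ i).card = a := by
      have := h (2 * m + 3) (by omega) (by omega)
      omega
    have hbot : (Finset.univ.filter fun i => 1 ≤ ρ i).card = a + 2 * m + 2 := by
      have := h 1 (by omega) (by omega)
      omega
    have key : ∀ A ∈ (Finset.univ.filter fun i => 2 * m + 3 ≤ ρ i).powerset,
        (if A.card ≤ 2 then ∑ g ∈ fillings (peelBound ρ A) m,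
          ((bottomRows ρ A g).powersetCard (2 - A.card)).card else 0)
        = (if A.card ≤ 2 then layerCount m (a + 1 - A.card)
            * (a + 1 - A.card).choose (2 - A.card) else 0) := by
      intro A hA
      have hA' : ∀ i ∈ A, 2 * m + 3 ≤ ρ i := fun i hi => by
        simpa using Finset.mem_powerset.mp hA hi
      have hAa : A.card ≤ a := htop ▸ Finset.card_le_card (Finset.mem_powerset.mp hA)
      have hcard : (fillings (peelBound ρ A) m).card = layerCount m (a + 1 - A.card) := by
        apply ih
        intro k hk hk'
        have h1 := card_le_peelBound hA' hk hk'
        have h2 := h (k + 1) (by omega) (by omega)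
        omega
      split_ifs with c
      · rw [← hcard, ← smul_eq_mul, ← Finset.sum_const]
        refine Finset.sum_congr rfl fun g hg => ?_
        rw [Finset.card_powersetCard, card_bottomRows hbot hA' hg]
      · rfl
    rw [card_fillings_succ_eq_sum, Finset.sum_filter, Finset.sum_congr rfl key,
      Finset.sum_powerset_apply_card (fun e => if e ≤ 2 then layerCount m (a + 1 - e)
        * (a + 1 - e).choose (2 - e) else 0), htop]
    have hF : ∀ e, 2 < e → a.choose e • (if e ≤ 2 then layerCount m (a + 1 - e)
        * (a + 1 - e).choose (2 - e) else 0) = 0 := fun e he => by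
      rw [if_neg (by omega), smul_zero]
    have hF' : ∀ e, a < e → a.choose e • (if e ≤ 2 then layerCount m (a + 1 - e)
        * (a + 1 - e).choose (2 - e) else 0) = 0 := fun e he => by
      rw [Nat.choose_eq_zero_of_lt he, zero_smul]
    -- only `e = 0, 1, 2` contribute
    rw [Finset.sum_subset (Finset.range_subset_range.mpr (by omega : a + 1 ≤ a + 3))
        fun e _ he => hF' e (by simp only [Finset.mem_range] at he; omega),
      ← Finset.sum_subset (Finset.range_subset_range.mpr (by omega : 3 ≤ a + 3))
        fun e _ he => hF e (by simp only [Finset.mem_range] at he; omega)]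
    simp [Finset.sum_range_succ, layerCount]
    ring

end Fillings

/-! ### Symmetric Dellac configurations as fillings -/

/-- Row `i` of the lower half of the tableau. -/
def lowRow {N : ℕ} (i : Fin N) : Fin (2 * N) := ⟨i, by omega⟩

lemma row_eq_lowRow_or {N : ℕ} (r : Fin (2 * N)) :
    (∃ i : Fin N, r = lowRow i) ∨ ∃ i : Fin N, r = (lowRow i).rev := by
  rcases lt_or_ge r.1 N with h | h
  · exact Or.inl ⟨⟨r, h⟩, rfl⟩
  · refine Or.inr ⟨⟨2 * N - 1 - r, by omega⟩, ?_⟩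
    ext
    simp only [lowRow, Fin.val_rev]
    omega

lemma lowRow_injective {N : ℕ} : Function.Injective (lowRow (N := N)) := fun i j h => by
  have := congrArg Fin.val h
  exact Fin.ext this

lemma lowRow_ne_rev {N : ℕ} (i j : Fin N) : lowRow i ≠ (lowRow j).rev := by
  intro h
  have := congrArg Fin.val h
  simp only [lowRow, Fin.val_rev] at this
  omega

/-- The centrally symmetric tableau with one point in each row, whose point in the lower row `i`
is in column `g i`. -/
def symmetricTableau {N : ℕ} (g : Fin N → Fin N) : DellacTableau N :=
  Finset.univ.image (fun i => (g i, lowRow i))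
    ∪ Finset.univ.image fun i => ((g i).rev, (lowRow i).rev)

lemma mem_symmetricTableau_lowRow {N : ℕ} {g : Fin N → Fin N} {j i : Fin N} :
    (j, lowRow i) ∈ symmetricTableau g ↔ g i = j := by
  simp only [symmetricTableau, Finset.mem_union, Finset.mem_image, Finset.mem_univ, true_and,
    Prod.mk.injEq]
  constructor
  · rintro (⟨k, h, hk⟩ | ⟨k, _, hk⟩)
    · rw [← lowRow_injective hk, h]
    · exact absurd hk.symm (lowRow_ne_rev i k)
  · exact fun h => Or.inl ⟨i, h, rfl⟩

lemma mem_symmetricTableau_rev {N : ℕ} {g : Fin N → Fin N} {j i : Fin N} :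
    (j, (lowRow i).rev) ∈ symmetricTableau g ↔ g i = j.rev := by
  simp only [symmetricTableau, Finset.mem_union, Finset.mem_image, Finset.mem_univ, true_and,
    Prod.mk.injEq]
  constructor
  · rintro (⟨k, _, hk⟩ | ⟨k, h, hk⟩)
    · exact absurd hk (lowRow_ne_rev k i)
    · rw [← lowRow_injective (Fin.rev_injective hk), ← h, Fin.rev_rev]
  · exact fun h => Or.inr ⟨i, by rw [h, Fin.rev_rev], rfl⟩

lemma symmetricTableau_injective {N : ℕ} :
    Function.Injective (symmetricTableau (N := N)) := by
  intro g g' h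
  funext i
  have := (mem_symmetricTableau_lowRow (g := g) (j := g i) (i := i)).mpr rfl
  rw [h, mem_symmetricTableau_lowRow] at this
  exact this.symm

lemma mem_dellacRotation {N : ℕ} {T : DellacTableau N} {j : Fin N} {r : Fin (2 * N)} :
    (j, r) ∈ dellacRotation T ↔ (j.rev, r.rev) ∈ T := by
  simp only [dellacRotation, Finset.mem_image, Prod.mk.injEq, Prod.exists]
  constructor
  · rintro ⟨a, b, h, rfl, rfl⟩
    simpa using h
  · exact fun h => ⟨_, _, h, by simp, by simp⟩

lemma dellacRotation_symmetricTableau {N : ℕ} (g : Fin N → Fin N) :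
    dellacRotation (symmetricTableau g) = symmetricTableau g := by
  ext ⟨j, r⟩
  rw [mem_dellacRotation]
  rcases row_eq_lowRow_or r with ⟨i, rfl⟩ | ⟨i, rfl⟩
  · rw [mem_symmetricTableau_rev, mem_symmetricTableau_lowRow, Fin.rev_rev]
  · rw [Fin.rev_rev, mem_symmetricTableau_rev, mem_symmetricTableau_lowRow]

lemma exists_eq_symmetricTableau {N : ℕ} {T : DellacTableau N}
    (hrow : ∀ i : Fin (2 * N), (T.filter fun p => p.2 = i).card = 1)
    (hsym : dellacRotation T = T) : ∃ g, T = symmetricTableau g := by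
  have h : ∀ i : Fin N, ∃ c, ∀ j, (j, lowRow i) ∈ T ↔ c = j := by
    intro i
    obtain ⟨⟨c, r⟩, hp⟩ := Finset.card_eq_one.mp (hrow (lowRow i))
    have hmem : ∀ q, q ∈ T ∧ q.2 = lowRow i ↔ q = (c, r) := fun q => by
      have : q ∈ T.filter (fun p => p.2 = lowRow i) ↔ q ∈ ({(c, r)} : Finset _) := by rw [hp]
      rwa [Finset.mem_filter, Finset.mem_singleton] at this
    have hr : r = lowRow i := ((hmem (c, r)).mpr rfl).2
    refine ⟨c, fun j => ?_⟩
    have := hmem (j, lowRow i)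
    simp only [and_true, Prod.mk.injEq, hr] at this
    rw [this, eq_comm]
  choose g hg using h
  refine ⟨g, ?_⟩
  ext ⟨j, r⟩
  rcases row_eq_lowRow_or r with ⟨i, rfl⟩ | ⟨i, rfl⟩
  · rw [hg, mem_symmetricTableau_lowRow]
  · rw [← hsym, mem_dellacRotation, Fin.rev_rev, hg, mem_symmetricTableau_rev]

lemma card_row_symmetricTableau {N : ℕ} (g : Fin N → Fin N) (r : Fin (2 * N)) :
    ((symmetricTableau g).filter fun p => p.2 = r).card = 1 := by
  rw [Finset.card_eq_one]
  rcases row_eq_lowRow_or r with ⟨i, rfl⟩ | ⟨i, rfl⟩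
  · refine ⟨(g i, lowRow i), ?_⟩
    ext ⟨j, r⟩
    simp only [Finset.mem_filter, Finset.mem_singleton, Prod.mk.injEq]
    constructor
    · rintro ⟨h, rfl⟩
      exact ⟨(mem_symmetricTableau_lowRow.mp h).symm, rfl⟩
    · rintro ⟨rfl, rfl⟩
      exact ⟨mem_symmetricTableau_lowRow.mpr rfl, rfl⟩
  · refine ⟨((g i).rev, (lowRow i).rev), ?_⟩
    ext ⟨j, r⟩
    simp only [Finset.mem_filter, Finset.mem_singleton, Prod.mk.injEq]
    constructor
    · rintro ⟨h, rfl⟩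
      exact ⟨by rw [mem_symmetricTableau_rev.mp h, Fin.rev_rev], rfl⟩
    · rintro ⟨rfl, rfl⟩
      exact ⟨mem_symmetricTableau_rev.mpr (Fin.rev_rev _).symm, rfl⟩

lemma card_column_symmetricTableau {N : ℕ} (g : Fin N → Fin N) (j : Fin N) :
    ((symmetricTableau g).filter fun p => p.1 = j).card
      = (Finset.univ.filter fun i => g i = j).card
        + (Finset.univ.filter fun i => g i = j.rev).card := by
  have h : ((symmetricTableau g).filter fun p => p.1 = j)
      = (Finset.univ.filter fun i => g i = j).image (fun i => (j, lowRow i))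
        ∪ (Finset.univ.filter fun i => g i = j.rev).image fun i => (j, (lowRow i).rev) := by
    ext ⟨c, r⟩
    simp only [Finset.mem_filter, Finset.mem_union, Finset.mem_image, Finset.mem_univ, true_and,
      Prod.mk.injEq]
    constructor
    · rintro ⟨h, rfl⟩
      rcases row_eq_lowRow_or r with ⟨i, rfl⟩ | ⟨i, rfl⟩
      · exact Or.inl ⟨i, mem_symmetricTableau_lowRow.mp h, rfl, rfl⟩
      · exact Or.inr ⟨i, mem_symmetricTableau_rev.mp h, rfl, rfl⟩
    · rintro (⟨i, h, rfl, rfl⟩ | ⟨i, h, rfl, rfl⟩)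
      · exact ⟨mem_symmetricTableau_lowRow.mpr h, rfl⟩
      · exact ⟨mem_symmetricTableau_rev.mpr h, rfl⟩
  rw [h, Finset.card_union_of_disjoint, Finset.card_image_of_injective,
    Finset.card_image_of_injective]
  · exact fun a b hab => lowRow_injective (Fin.rev_injective (Prod.ext_iff.mp hab).2)
  · exact fun a b hab => lowRow_injective (Prod.ext_iff.mp hab).2
  · rw [Finset.disjoint_left]
    intro p hp hp'
    obtain ⟨a, _, rfl⟩ := Finset.mem_image.mp hp
    obtain ⟨b, _, hb⟩ := Finset.mem_image.mp hp'
    exact lowRow_ne_rev a b (Prod.ext_iff.mp hb).2.symm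

/-- The bound `r ≤ N + j` is automatic for the lower rows, and in the upper rows the two bounds are
the rotated ones, so only `g i ≤ i` remains of the boundary conditions. -/
lemma isDellac_symmetricTableau_iff {N : ℕ} (g : Fin N → Fin N) :
    IsDellac (symmetricTableau g) ↔ (∀ i, g i ≤ i) ∧ ∀ j,
      (Finset.univ.filter fun i => g i = j).card
        + (Finset.univ.filter fun i => g i = j.rev).card = 2 := by
  simp only [IsDellac, card_column_symmetricTableau]
  constructor
  · rintro ⟨-, h2, h3⟩
    exact ⟨fun i => (h3 (g i, lowRow i) (mem_symmetricTableau_lowRow.mpr rfl)).1, h2⟩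
  · rintro ⟨h1, h2⟩
    refine ⟨card_row_symmetricTableau g, h2, ?_⟩
    rintro ⟨j, r⟩ hp
    rcases row_eq_lowRow_or r with ⟨i, rfl⟩ | ⟨i, rfl⟩
    · have h := mem_symmetricTableau_lowRow.mp hp
      have := Fin.le_def.mp (h1 i)
      rw [h] at this
      simp only [lowRow]
      omega
    · have h := mem_symmetricTableau_rev.mp hp
      have := Fin.le_def.mp (h1 i)
      rw [h, Fin.val_rev] at this
      simp only [lowRow, Fin.val_rev]
      omega

/-- Shifting the columns by one, so that `0` is free to mean "unused", turns symmetric Dellac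
configurations into fillings; as there are as many rows as there are points to place, no row stays
unused. -/
lemma card_symmetricDellac (m : ℕ) : (symmetricDellac (2 * m + 1)).card
    = (fillings (fun i : Fin (2 * m + 1) => (i : ℕ) + 1) m).card := by
  have hiff : ∀ g : Fin (2 * m + 1) → Fin (2 * m + 1), IsDellac (symmetricTableau g) ↔
      (fun i => (g i : ℕ) + 1) ∈ fillings (fun i : Fin (2 * m + 1) => (i : ℕ) + 1) m := by
    intro g
    rw [isDellac_symmetricTableau_iff, mem_fillings]
    have key : ∀ (j : Fin (2 * m + 1)) (k : ℕ), (j : ℕ) + 1 = k →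
        (Finset.univ.filter fun i => (g i : ℕ) + 1 = k) = Finset.univ.filter fun i => g i = j := by
      rintro j k rfl
      ext i
      simp [Fin.ext_iff]
    constructor
    · rintro ⟨h1, h2⟩
      refine ⟨fun i => ⟨Nat.succ_le_succ (h1 i), (g i).isLt⟩, fun k hk hk' => ?_⟩
      rw [key ⟨k - 1, by omega⟩ k (by simp only; omega),
        key (Fin.rev ⟨k - 1, by omega⟩) _ (by simp only [Fin.val_rev]; omega)]
      exact h2 _
    · rintro ⟨h1, h2⟩
      refine ⟨fun i => Nat.le_of_succ_le_succ (h1 i).1, fun j => ?_⟩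
      have h := h2 (j + 1) (by omega) (by omega)
      rwa [key j _ rfl, key j.rev _ (by simp only [Fin.val_rev]; omega)] at h
  have hpos : ∀ f ∈ fillings (fun i : Fin (2 * m + 1) => (i : ℕ) + 1) m, ∀ i, f i ≠ 0 := by
    intro f hf i
    have h := card_ne_zero_of_mem_fillings hf
    have h' : (Finset.univ.filter fun i => f i ≠ 0) = Finset.univ :=
      Finset.eq_univ_of_card _ (by rw [h, Fintype.card_fin])
    simpa using Finset.mem_univ i |> h'.symm.subset
  have h1 : symmetricDellac (2 * m + 1) = (Finset.univ.filter fun g => (fun i => (g i : ℕ) + 1)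
      ∈ fillings (fun i : Fin (2 * m + 1) => (i : ℕ) + 1) m).image symmetricTableau := by
    ext T
    simp only [symmetricDellac, Finset.mem_filter, Finset.mem_univ, true_and, Finset.mem_image]
    constructor
    · rintro ⟨hT, hs⟩
      obtain ⟨g, rfl⟩ := exists_eq_symmetricTableau hT.1 hs
      exact ⟨g, (hiff g).mp hT, rfl⟩
    · rintro ⟨g, hg, rfl⟩
      exact ⟨(hiff g).mpr hg, dellacRotation_symmetricTableau g⟩
  rw [h1, Finset.card_image_of_injective _ symmetricTableau_injective]
  refine Finset.card_bij (fun g _ i => (g i : ℕ) + 1) ?_ ?_ ?_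
  · intro g hg
    simpa using hg
  · intro g _ g' _ h
    funext i
    have := congrFun h i
    ext
    simpa using this
  · intro f hf
    have hb := (mem_fillings.mp hf).1
    have e : (fun i => f i - 1 + 1) = f := by
      funext i
      have := hpos f hf i
      omega
    refine ⟨fun i => ⟨f i - 1, by have := hb i; omega⟩, ?_, e⟩
    simpa [e] using hf

lemma card_symmetricDellac_eq_layerCount (m : ℕ) :
    (symmetricDellac (2 * m + 1)).card = layerCount m 1 := by
  rw [card_symmetricDellac]
  refine card_fillings m _ 1 fun k hk hk' => ?_
  have h : (Finset.univ.filter fun i : Fin (2 * m + 1) => k ≤ (i : ℕ) + 1)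
      = Finset.Ici (⟨k - 1, by omega⟩ : Fin (2 * m + 1)) := by
    ext i
    simp only [Finset.mem_filter, Finset.mem_univ, true_and, Finset.mem_Ici, Fin.le_def]
    omega
  rw [h, Fin.card_Ici]
  simp only
  omega

/-! ### The enumeration theorem -/

theorem mainTheorem4 :
    (∀ n : ℕ, 1 ≤ n →
      ((symmetricDellac (2 * n - 1)).card : ℚ) = seqL n ∧ seqL n = (eulerP n).eval 1) ∧
    seqL 0 = 1 ∧ seqL 1 = 1 ∧ seqL 2 = 3 ∧ seqL 3 = 21 ∧ seqL 4 = 267 := by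
  refine ⟨fun n hn => ?_, ?_⟩
  · obtain ⟨m, rfl⟩ := Nat.exists_eq_add_of_le' hn
    rw [show 2 * (m + 1) - 1 = 2 * m + 1 by omega, card_symmetricDellac_eq_layerCount,
      layerCount_one, seqL_succ]
    exact ⟨rfl, by simp [oddValue]⟩
  · simp only [seqL_succ, oddValue_succ, oddValue_zero]
    refine ⟨by simp [seqL, eulerD], ?_⟩
    norm_num
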